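/- Let $n,\beta,k\ge 1$ and $\ell\ge 0$ be integers, let $1\le s_1<\dots<s_k\le\lfloor \beta n/2\rfloor$ and $1\le \alpha_1<\dots<\alpha_\ell\le\lfloor\beta/2\rfloor$ be integers, and put $q=s_1^2+\dots+s_k^2$. Let $C_{\beta n}(s_1,\dots,s_k,\alpha_1 n,\dots,\alpha_\ell n)$ be the circulant multigraph with vertex set $\mathbb Z/\beta n$ which, for every entry $a$ of the list of jumps $s_1,\dots,s_k,\alpha_1n,\dots,\alpha_\ell n$ and every vertex $v$, has one edge joining $v$ and $v+a$ (so a jump $a=\beta n/2$, or a value that occurs twice in the list, produces multiple edges), and let $\tau(n)$ be its number of spanning trees. For $u=0,1,\dots,\beta-1$ the polynomial equation $$\sum_{i=1}^k T_{s_i}(w)=k+2\sum_{m=1}^{\ell}\sin^2\Big(\frac{\pi u\alpha_m}{\beta}\Big),$$ where $T_s$ denotes the Chebyshev polynomial of the first kind, has exactly $s_k$ complex roots counted with multiplicity. Denote them by $w_1(u),\dots,w_{s_k}(u)$. Then $$\tau(n)=\frac{n}{\beta q}\;\prod_{\substack{1\le j\le s_k\\ w_j(0)\ne 1}}\big|2T_n(w_j(0))-2\big|\;\cdot\;\prod_{u=1}^{\beta-1}\prod_{j=1}^{s_k}\Big|2T_n(w_j(u))-2\cos\Big(\frac{2\pi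 u}{\beta}\Big)\Big|.$$ -/

import Mathlib

open Polynomial

/-- A set `F` of edges of a multigraph `G` is (the edge set of) a spanning tree if the spanning
subgraph with edge set `F` is a tree: it has neither loops nor parallel edges, and as a simple
graph it is connected and acyclic. -/
def IsSpanningTree {V E : Type*} (G : Graph V E) (F : Set E) : Prop :=
  F ⊆ G.edgeSet ∧ (G.restrict F).Simple ∧ (G.restrict F).toSimpleGraph.IsTree

/-- The number of spanning trees of a multigraph. -/
noncomputable def numSpanningTrees {V E : Type*} (G : Graph V E) : ℕ :=
  {F : Set E | IsSpanningTree G F}.ncard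

/-- The circulant multigraph on `ℤ/N` with the family of jumps `a`: for each jump index `i` and
each vertex `v` there is one edge `(i, v)`, joining `v` and `v + a i`. Thus a jump equal to `N / 2`,
and jumps that are listed twice, give rise to double edges. -/
def circulantMultigraph (N : ℕ) {ι : Type*} (a : ι → ℕ) : Graph (ZMod N) (ι × ZMod N) where
  vertexSet := Set.univ
  IsLink e x y := s(x, y) = s(e.2, e.2 + (a e.1 : ZMod N))
  isLink_symm := fun _ _ => ⟨fun _ _ h => Sym2.eq_swap.trans h⟩
  eq_or_eq_of_isLink_of_isLink := by
    intro e x y v w h h'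
    rcases Sym2.eq_iff.1 (h.trans h'.symm) with h1 | h1
    · exact Or.inl h1.1
    · exact Or.inr h1.1
  left_mem_of_isLink := fun _ _ _ _ => Set.mem_univ _

/-- The polynomial `∑ᵢ T_{sᵢ}(w) - (k + 2 ∑ₘ sin²(π u αₘ / β))`. -/
noncomputable def chebyshevEquation {k l : ℕ} (β : ℕ) (s : Fin k → ℕ) (α : Fin l → ℕ) (u : ℕ) :
    ℂ[X] :=
  (∑ i, Chebyshev.T ℂ (s i : ℤ)) -
    C (((k : ℝ) + 2 * ∑ m, Real.sin (Real.pi * u * α m / β) ^ 2 : ℝ) : ℂ)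

/-! The matrix-tree theorem and Fourier analysis on `ZMod (β * n)` give βn·τ(n) as the product of
the nonzero-frequency Laplacian eigenvalues. At frequency j = u + βt a jump αₘn contributes a term
independent of t, so the eigenvalue is -2 P_u(cos(2πj/(βn))), with P_u the polynomial
`chebyshevEquation` (`eigenvalue_eq_chebyshevEquation`). For fixed u the angles form a progression
of step 2π/n. Factoring 2P_u over its roots and swapping the products leaves one factor 2T_n(w) -
2cos(2πu/β) per root, up to sign (`prod_two_mul_sub_two_mul_cos`). For u = 0 the term t = 0 is
missing and 1 is a simple root with P_0'(1) = q; removing both yields n²/q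
(`prod_erase_two_mul_eval_cos_mul`). Dividing by βn gives n/(βq). The matrix-tree theorem is
obtained by expanding the reduced determinant over choices of one dart at each non-root vertex: a
choice contributes 1 if it leads to the root and 0 otherwise. The contributing choices are spanning
trees oriented towards the root. -/

/-! ### Determinants of functional digraphs -/

/-- A parent function `g`, defined away from the root `r`, is rooted if following it decreases some
depth function; equivalently, all its iterations end at `r`. -/
def IsRootedAt {V : Type*} (r : V) (g : {v : V // v ≠ r} → V) : Prop :=
  ∃ d : V → ℕ, ∀ v, d (g v) < d v

/-- The matrix with rows `δ_v - δ_{g v}`, restricted to the columns different from `r`. -/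
def parentMatrix {V : Type*} [DecidableEq V] (R : Type*) [Ring R] (r : V)
    (g : {v : V // v ≠ r} → V) : Matrix {v : V // v ≠ r} {v : V // v ≠ r} R :=
  Matrix.of fun v w => (if v = w then 1 else 0) - (if g v = w then 1 else 0)

/-- Sorted by depth the matrix is triangular, and vertices of equal depth give an identity block. -/
lemma IsRootedAt.det_parentMatrix {V R : Type*} [Fintype V] [DecidableEq V] [CommRing R] {r : V}
    {g : {v : V // v ≠ r} → V} (hg : IsRootedAt r g) : (parentMatrix R r g).det = 1 := by
  obtain ⟨d, hd⟩ := hg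
  have hne : ∀ v w : {v : V // v ≠ r}, d v ≤ d w → g v ≠ w := fun v w h h' =>
    absurd (hd v) (by rw [h']; omega)
  have hb : (parentMatrix R r g).BlockTriangular
      (fun v : {v : V // v ≠ r} => OrderDual.toDual (d v)) := by
    intro v w hvw
    have hvw : d v < d w := hvw
    have h1 : v ≠ w := by rintro rfl; exact lt_irrefl _ hvw
    simp [parentMatrix, h1, hne v w hvw.le]
  rw [hb.det]
  refine Finset.prod_eq_one fun a _ => ?_
  suffices h : (parentMatrix R r g).toSquareBlock (fun v => OrderDual.toDual (d v)) a = 1 by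
    rw [h, Matrix.det_one]
  ext ⟨v, hv⟩ ⟨w, hw⟩
  have : d v = d w := OrderDual.toDual.injective (hv.trans hw.symm)
  simp [parentMatrix, Matrix.toSquareBlock_def, hne v w this.le, Matrix.one_apply]

/-- If every orbit reached `r`, the hitting time would be a depth function. Otherwise the indicator
of the vertices that never reach `r` is a nonzero kernel vector. -/
lemma det_parentMatrix_eq_zero {V R : Type*} [Fintype V] [DecidableEq V] [CommRing R] [IsDomain R]
    {r : V} {g : {v : V // v ≠ r} → V} (hg : ¬ IsRootedAt r g) : (parentMatrix R r g).det = 0 := by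
  classical
  set step : V → V := fun v => if h : v ≠ r then g ⟨v, h⟩ else r with hstep
  have step_of : ∀ v : {v : V // v ≠ r}, step v = g v := fun v => by simp [hstep, v.2]
  have step_r : step r = r := by simp [hstep]
  by_cases hall : ∀ v, ∃ m, step^[m] v = r
  · refine absurd ⟨fun v => Nat.find (hall v), fun v => ?_⟩ hg
    obtain ⟨m, hm⟩ : ∃ m, Nat.find (hall v) = m + 1 := by
      refine Nat.exists_eq_succ_of_ne_zero fun h0 => v.2 ?_
      have := Nat.find_spec (hall v)
      rwa [h0] at this
    have h := Nat.find_spec (hall v)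
    rw [hm, Function.iterate_succ_apply, step_of] at h
    have := Nat.find_min' (hall (g v)) h
    dsimp only
    omega
  · push Not at hall
    obtain ⟨v₀, hv₀⟩ := hall
    rw [← Matrix.exists_mulVec_eq_zero_iff]
    have hstep_iff : ∀ v, (∃ m, step^[m] (step v) = r) ↔ ∃ m, step^[m] v = r := by
      refine fun v => ⟨fun ⟨m, hm⟩ => ⟨m + 1, by rwa [Function.iterate_succ_apply]⟩,
        fun ⟨m, hm⟩ => ⟨m, ?_⟩⟩
      rw [← Function.iterate_succ_apply, Function.iterate_succ_apply', hm, step_r]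
    refine ⟨fun v => if ∃ m, step^[m] v = r then 0 else 1, fun h => ?_, ?_⟩
    · have := congrFun h ⟨v₀, hv₀ 0⟩
      simp only [Pi.zero_apply, ite_eq_left_iff, one_ne_zero, imp_false, not_not] at this
      exact this.elim hv₀
    · ext v
      simp only [Matrix.mulVec, dotProduct, parentMatrix, Matrix.of_apply, sub_mul,
        Finset.sum_sub_distrib, ite_mul, one_mul, zero_mul, Finset.sum_ite_eq, Finset.mem_univ,
        if_true, Pi.zero_apply]
      rw [← hstep_iff, step_of, sub_eq_zero]
      by_cases hr : g v = r
      · rw [if_pos ⟨0, hr⟩, Finset.sum_eq_zero]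
        intro w _
        rw [if_neg fun h => w.2 (h.symm.trans hr)]
      · rw [Finset.sum_eq_single ⟨g v, hr⟩]
        · simp
        · intro w _ hw
          rw [if_neg fun h => hw (Subtype.ext h.symm)]
        · simp

/-- The multilinear expansion of the determinant of a reduced Laplacian along the out-darts of the
vertices: it counts the choices of a dart at each non-root vertex that lead to the root. -/
lemma det_reduced_laplacian_eq_ncard {V D R : Type*} [Fintype V] [DecidableEq V]
    [Fintype D] [CommRing R] [IsDomain R] (r : V) (head : V → D → V) :
    (Matrix.of fun v w : {v : V // v ≠ r} =>
      ∑ d, ((if v = w then (1 : R) else 0) - if head v d = w then 1 else 0)).det =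
    {c : {v : V // v ≠ r} → D | IsRootedAt r fun v => head v (c v)}.ncard := by
  classical
  have h := (Matrix.detRowAlternating (R := R) (n := {v : V // v ≠ r})).toMultilinearMap.map_sum
    (fun v (d : D) (w : {v : V // v ≠ r}) => (if v = w then (1 : R) else 0) - if head v d = w then 1 else 0)
  have h' : (Matrix.of fun v w : {v : V // v ≠ r} =>
      ∑ d, ((if v = w then (1 : R) else 0) - if head v d = w then 1 else 0)) =
      fun v : {v : V // v ≠ r} => ∑ d, fun w : {v : V // v ≠ r} => (if v = w then (1 : R) else 0) - if head v d = w then 1 else 0 := by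
    ext v w
    simp [Finset.sum_apply]
  rw [h']
  refine h.trans ?_
  rw [Set.ncard_eq_toFinset_card', Finset.card_eq_sum_ones, Set.toFinset_ofPred, Finset.sum_filter,
    Nat.cast_sum]
  refine Finset.sum_congr rfl fun c _ => ?_
  change (parentMatrix R r fun v => head v (c v)).det = _
  split_ifs with hc
  · simp [hc.det_parentMatrix]
  · simp [det_parentMatrix_eq_zero hc]

/-! ### The matrix-tree theorem -/

/-- `f` sends each vertex other than `r` to an edge leading to a parent of smaller depth. -/
def IsParentEdgeMap {V E : Type*} (G : Graph V E) (r : V) (f : {v : V // v ≠ r} → E) : Prop :=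
  ∃ d : V → ℕ, ∀ v, ∃ w, G.IsLink (f v) v w ∧ d w < d v

namespace IsParentEdgeMap

variable {V E : Type*} {G : Graph V E} {r : V} {f f' : {v : V // v ≠ r} → E}

lemma injective (hf : IsParentEdgeMap G r f) : Function.Injective f := by
  obtain ⟨d, hd⟩ := hf
  intro v v' h
  obtain ⟨w, hw, hdw⟩ := hd v
  obtain ⟨w', hw', hdw'⟩ := hd v'
  rw [h] at hw
  rcases hw.eq_and_eq_or_eq_and_eq hw' with ⟨h1, -⟩ | ⟨h1, h2⟩
  · exact Subtype.ext h1
  · rw [← h1] at hdw'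
    rw [h2] at hdw
    omega

/-- Induction on depth: if `f v = f' x` with `x ≠ v`, then `x` is the parent of `v` under `f`, so `f
x = f' x = f v` by induction, against injectivity. -/
lemma eq_of_range_eq (hf : IsParentEdgeMap G r f) (hf' : IsParentEdgeMap G r f')
    (h : Set.range f = Set.range f') : f = f' := by
  have hinj := hf.injective
  obtain ⟨d, hd⟩ := hf
  obtain ⟨d', hd'⟩ := hf'
  suffices H : ∀ m, ∀ v : {v : V // v ≠ r}, d v = m → f v = f' v from funext fun v => H _ v rfl
  intro m
  induction m using Nat.strong_induction_on with
  | _ m ih =>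
    intro v hv
    obtain ⟨w, hw, hdw⟩ := hd v
    obtain ⟨x, hx⟩ : f v ∈ Set.range f' := h ▸ Set.mem_range_self v
    obtain ⟨y, hy, hdy⟩ := hd' x
    rw [hx] at hy
    rcases hw.eq_and_eq_or_eq_and_eq hy with ⟨h1, -⟩ | ⟨h1, h2⟩
    · rw [← hx, Subtype.ext h1]
    · subst h2
      have := ih (d x) (hv ▸ hdw) x rfl
      rw [hx] at this
      have := hinj this
      subst this
      exact absurd hdw (lt_irrefl _)

lemma isSpanningTree [Finite V] (hV : G.vertexSet = Set.univ) (hf : IsParentEdgeMap G r f) :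
    IsSpanningTree G (Set.range f) := by
  classical
  have hinj := hf.injective
  obtain ⟨d, hd⟩ := hf
  choose p hp hdp using hd
  have hadj : ∀ v : {v : V // v ≠ r}, (G.restrict (Set.range f)).Adj v (p v) := fun v =>
    ⟨f v, by simpa using hp v⟩
  have hsimple : (G.restrict (Set.range f)).Simple := by
    -- Depth drops along `f v`, so its deeper end is `v`: this rules out loops, and parallel edges
    -- share their deeper end.
    have key : ∀ (v : {v : V // v ≠ r}) (x y : V), G.IsLink (f v) x y → (x = v.1 ∧ y = p v) ∨ (x = p v ∧ y = v.1) :=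
      fun v x y h => h.eq_and_eq_or_eq_and_eq (hp v)
    refine { not_isLoopAt := ?_, eq_of_isLink := ?_ }
    · rintro e x h
      rw [Graph.restrict_isLoopAt] at h
      obtain ⟨h, v, rfl⟩ := h
      have := hdp v
      rcases key v x x h with ⟨h1, h2⟩ | ⟨h1, h2⟩ <;> rw [← h1, ← h2] at this <;> omega
    · rintro e e' x y he he'
      rw [Graph.restrict_isLink, and_comm] at he he'
      obtain ⟨v, rfl⟩ := he.2
      obtain ⟨v', rfl⟩ := he'.2
      have h1 := hdp v
      have h2 := hdp v'
      rcases key v x y he.1 with ⟨hx, hy⟩ | ⟨hx, hy⟩ <;>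
      rcases key v' x y he'.1 with ⟨hx', hy'⟩ | ⟨hx', hy'⟩
      · rw [Subtype.ext (hx.symm.trans hx')]
      · rw [← hx, ← hy] at h1; rw [← hx', ← hy'] at h2; omega
      · rw [← hx, ← hy] at h1; rw [← hx', ← hy'] at h2; omega
      · rw [Subtype.ext (hy.symm.trans hy')]
  refine ⟨?_, hsimple, ?_⟩
  · rintro _ ⟨v, rfl⟩
    exact (hp v).edge_mem
  have hmem : ∀ v : V, v ∈ (G.restrict (Set.range f)).vertexSet := fun v => by simp [hV]
  set T := (G.restrict (Set.range f)).toSimpleGraph with hT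
  have hTadj : ∀ v : {v : V // v ≠ r}, T.Adj ⟨v, hmem v⟩ ⟨p v, hmem _⟩ := fun v => by
    rw [hT, Graph.toSimpleGraph_adj_iff]
    exact hadj v
  have hreach : ∀ m, ∀ v, d v = m → T.Reachable ⟨v, hmem v⟩ ⟨r, hmem r⟩ := by
    intro m
    induction m using Nat.strong_induction_on with
    | _ m ih =>
      intro v hv
      by_cases hr : v = r
      · subst hr; rfl
      · exact (hTadj ⟨v, hr⟩).reachable.trans (ih _ (hv ▸ hdp ⟨v, hr⟩) _ rfl)
  have hconn : T.Connected := by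
    have : Nonempty (G.restrict (Set.range f)).vertexSet := ⟨⟨r, hmem r⟩⟩
    exact ⟨fun x y => (hreach _ x rfl).trans (hreach _ y rfl).symm⟩
  -- Acyclicity comes from counting: the non-root vertices surject onto the edges.
  rw [SimpleGraph.isTree_iff_connected_and_card]
  refine ⟨hconn, le_antisymm ?_ hconn.card_vert_le_card_edgeSet_add_one⟩
  have hcard : Nat.card (G.restrict (Set.range f)).vertexSet = Nat.card {v : V // v ≠ r} + 1 := by
    rw [Nat.card_congr (Equiv.subtypeUnivEquiv hmem)]
    rw [← Nat.card_congr (Equiv.optionSubtypeNe r), Finite.card_option]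
  rw [hcard]
  refine Nat.add_le_add_right ?_ 1
  refine Nat.card_le_card_of_surjective
    (fun v : {v : V // v ≠ r} => (⟨s(⟨v, hmem v⟩, ⟨p v, hmem _⟩), hTadj v⟩ : T.edgeSet)) ?_
  rintro ⟨e, he⟩
  induction e using Sym2.ind with
  | _ x y =>
    have he' : T.Adj x y := he
    rw [hT, Graph.toSimpleGraph_adj_iff] at he'
    obtain ⟨e, he''⟩ := he'
    rw [Graph.restrict_isLink, and_comm] at he''
    obtain ⟨h, v, rfl⟩ := he''
    refine ⟨v, Subtype.ext ?_⟩
    rw [Sym2.eq_iff]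
    rcases (hp v).eq_and_eq_or_eq_and_eq h with ⟨h1, h2⟩ | ⟨h1, h2⟩
    · exact Or.inl ⟨Subtype.ext h1, Subtype.ext h2⟩
    · exact Or.inr ⟨Subtype.ext h1, Subtype.ext h2⟩

end IsParentEdgeMap

lemma IsSpanningTree.finite_and_ncard_lt {V E : Type*} [Finite V] {G : Graph V E} {F : Set E}
    (hF : IsSpanningTree G F) : F.Finite ∧ F.ncard < Nat.card G.vertexSet := by
  obtain ⟨hsub, hsimple, htree⟩ := hF
  have hlink : ∀ e : F, ∃ x y : (G.restrict F).vertexSet, (G.restrict F).IsLink e x y := by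
    rintro ⟨e, he⟩
    obtain ⟨x, y, hxy⟩ := G.exists_isLink_of_mem_edgeSet (hsub he)
    exact ⟨⟨x, hxy.left_mem⟩, ⟨y, hxy.right_mem⟩, by simp [he, hxy]⟩
  choose x y hxy using hlink
  set T := (G.restrict F).toSimpleGraph with hT
  have hadj : ∀ e, T.Adj (x e) (y e) := fun e => by
    rw [hT, Graph.toSimpleGraph_adj_iff]
    exact ⟨e, hxy e⟩
  have hinj : Function.Injective (fun e => (⟨s(x e, y e), hadj e⟩ : T.edgeSet)) := by
    intro e e' h
    have h' := Sym2.eq_iff.1 (congrArg Subtype.val h)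
    have he := hxy e
    refine Subtype.ext ?_
    rcases h' with ⟨h1, h2⟩ | ⟨h1, h2⟩ <;> rw [h1, h2] at he
    · exact he.eq (hxy e')
    · exact he.symm.eq (hxy e')
  refine ⟨Finite.of_injective _ hinj, ?_⟩
  have hcard := (SimpleGraph.isTree_iff_connected_and_card.1 htree).2
  have := Nat.card_le_card_of_injective _ hinj
  rw [Nat.card_coe_set_eq] at this
  have h1 : Nat.card T.edgeSet + 1 = Nat.card G.vertexSet := hcard
  have h2 : F.ncard ≤ Nat.card T.edgeSet := this
  omega

lemma IsSpanningTree.exists_isParentEdgeMap {V E : Type*} [Finite V] {G : Graph V E} {F : Set E}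
    (hV : G.vertexSet = Set.univ) (r : V) (hF : IsSpanningTree G F) :
    ∃ f, IsParentEdgeMap G r f ∧ Set.range f = F := by
  classical
  obtain ⟨hfin, hcard⟩ := hF.finite_and_ncard_lt
  have hmem : ∀ v : V, v ∈ (G.restrict F).vertexSet := fun v => by simp [hV]
  obtain ⟨hsub, hsimple, htree⟩ := hF
  set T := (G.restrict F).toSimpleGraph with hT
  -- The parent is the next vertex on a shortest path to `r`, with graph distance as depth.
  have hpar : ∀ v : {v : V // v ≠ r}, ∃ e w, e ∈ F ∧ G.IsLink e v w ∧
      T.dist ⟨w, hmem w⟩ ⟨r, hmem r⟩ < T.dist ⟨v, hmem v⟩ ⟨r, hmem r⟩ := by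
    rintro ⟨v, hv⟩
    obtain ⟨p, hp⟩ := htree.1.exists_walk_length_eq_dist ⟨v, hmem v⟩ ⟨r, hmem r⟩
    cases p with
    | nil => exact absurd rfl hv
    | @cons _ w _ h q =>
      have hq := SimpleGraph.dist_le q
      rw [SimpleGraph.Walk.length_cons] at hp
      rw [hT, Graph.toSimpleGraph_adj_iff] at h
      obtain ⟨e, he⟩ := h
      rw [Graph.restrict_isLink, and_comm] at he
      exact ⟨e, w, he.2, he.1, lt_of_le_of_lt hq (hp ▸ Nat.lt_succ_self _)⟩
  choose f w hfF hlink hlt using hpar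
  have hf : IsParentEdgeMap G r f :=
    ⟨fun v => T.dist ⟨v, hmem v⟩ ⟨r, hmem r⟩, fun v => ⟨w v, hlink v, hlt v⟩⟩
  -- By injectivity the range has |V| - 1 elements, and `F` has no more.
  refine ⟨f, hf, Set.eq_of_subset_of_ncard_le (Set.range_subset_iff.2 hfF) ?_ hfin⟩
  rw [← Nat.card_coe_set_eq (Set.range f), Nat.card_range_of_injective hf.injective]
  have h1 : Nat.card G.vertexSet = Nat.card V := by rw [hV]; simp
  have h2 : Nat.card V = Nat.card {v : V // v ≠ r} + 1 := by
    rw [← Nat.card_congr (Equiv.optionSubtypeNe r), Finite.card_option]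
  omega

lemma numSpanningTrees_eq_ncard_isParentEdgeMap {V E : Type*} [Finite V] (G : Graph V E)
    (hV : G.vertexSet = Set.univ) (r : V) :
    numSpanningTrees G = {f | IsParentEdgeMap G r f}.ncard := by
  symm
  refine Set.ncard_congr (fun f _ => Set.range f) (fun f hf => hf.isSpanningTree hV)
    (fun f f' hf hf' h => hf.eq_of_range_eq hf' h) fun F hF => ?_
  obtain ⟨f, hf, h⟩ := IsSpanningTree.exists_isParentEdgeMap hV r hF
  exact ⟨f, hf, h⟩

/-- The matrix-tree theorem for a multigraph whose edges at a vertex `v` are enumerated without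
repetition by `edge v`, the other end of `edge v d` being `head v d`. -/
theorem numSpanningTrees_eq_det {V E D R : Type*} [Fintype V] [DecidableEq V] [Fintype D]
    [CommRing R] [IsDomain R] (G : Graph V E) (hV : G.vertexSet = Set.univ) (r : V)
    (head : V → D → V) (edge : V → D → E) (hinj : ∀ v, Function.Injective (edge v))
    (hlink : ∀ v d, G.IsLink (edge v d) v (head v d))
    (hsurj : ∀ e v w, G.IsLink e v w → ∃ d, edge v d = e) :
    (numSpanningTrees G : R) = (Matrix.of fun v w : {v : V // v ≠ r} =>
      ∑ d, ((if v = w then (1 : R) else 0) - if head v d = w then 1 else 0)).det := by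
  rw [det_reduced_laplacian_eq_ncard, numSpanningTrees_eq_ncard_isParentEdgeMap G hV r]
  congr 1
  symm
  refine Set.ncard_congr (fun c _ v => edge v (c v)) ?_ ?_ ?_
  · rintro c ⟨d, hd⟩
    exact ⟨d, fun v => ⟨_, hlink v (c v), hd v⟩⟩
  · exact fun c c' _ _ h => funext fun v => hinj v (congrFun h v)
  · rintro f ⟨d, hd⟩
    choose w hw hdw using hd
    choose c hc using fun v => hsurj _ _ _ (hw v)
    refine ⟨c, ⟨d, fun v => ?_⟩, funext hc⟩
    have h := hlink v (c v)
    rw [hc] at h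
    simpa only [h.right_unique (hw v)] using hdw v

/-! ### Spanning trees of circulant multigraphs in terms of Laplacian eigenvalues -/

/-- Adding the all-ones matrix `J` to a matrix `M` with vanishing row and column sums gives
determinant `|V|²` times that of `M` with one row and column removed. -/
lemma det_add_ones_eq {V R : Type*} [Fintype V] [DecidableEq V] [CommRing R] (r : V)
    (M : Matrix V V R) (hrow : ∀ v, ∑ w, M v w = 0) (hcol : ∀ w, ∑ v, M v w = 0) :
    (M + Matrix.of fun _ _ => 1).det =
      (Fintype.card V : R) ^ 2 *
        (M.submatrix (Subtype.val : {v : V // v ≠ r} → V) Subtype.val).det := by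
  set M' := M.submatrix (Subtype.val : {v : V // v ≠ r} → V) Subtype.val with hM'
  let e : {v : V // v ≠ r} ⊕ Unit ≃ V :=
    (Equiv.optionEquivSumPUnit _).symm.trans (Equiv.optionSubtypeNe r)
  have he1 : ∀ v, e (Sum.inl v) = v := fun v => by simp [e]
  have he2 : ∀ u, e (Sum.inr u) = r := fun u => by simp [e]
  have hsum : ∀ f : V → R, ∑ v, f v = ∑ v : {v : V // v ≠ r}, f v + f r := fun f => by
    rw [← e.sum_comp, Fintype.sum_sum_type]
    simp [he1, he2]
  -- Since the rows and columns of M sum to zero, M + J = K · diag(M', 1) · Kᵀ with det K = |V|.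
  let K : Matrix ({v : V // v ≠ r} ⊕ Unit) ({v : V // v ≠ r} ⊕ Unit) R :=
    Matrix.fromBlocks 1 (Matrix.of fun _ _ => 1) (Matrix.of fun _ _ => -1) 1
  have hK : K.det = Fintype.card V := by
    have hc : (Fintype.card V : R) = (Fintype.card {v : V // v ≠ r} : R) + 1 := by
      rw [← Fintype.card_congr e]
      simp
    rw [Matrix.det_fromBlocks_one₁₁, hc, Matrix.det_unique]
    simp [Matrix.mul_apply, add_comm]
  have hfac : (M + Matrix.of fun _ _ => 1).submatrix e e =
      K * Matrix.fromBlocks M' 0 0 1 * K.transpose := by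
    have hr1 : ∀ v, M v r = -∑ w : {v : V // v ≠ r}, M v w := fun v => by
      have := hrow v
      rw [hsum] at this
      exact eq_neg_of_add_eq_zero_right this
    have hr2 : ∀ w, M r w = -∑ v : {v : V // v ≠ r}, M v w := fun w => by
      have := hcol w
      rw [hsum] at this
      exact eq_neg_of_add_eq_zero_right this
    rw [Matrix.fromBlocks_transpose, Matrix.fromBlocks_multiply, Matrix.fromBlocks_multiply]
    ext (v | v) (w | w)
    · simp [he1, hM', Matrix.mul_apply]
    · simp [he1, he2, hM', Matrix.mul_apply, hr1]
    · simp [he1, he2, hM', Matrix.mul_apply, hr2]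
    · simp only [Matrix.submatrix_apply, he2, Matrix.add_apply, hr2 r, hr1]
      simp [hM', Matrix.mul_apply]
      rw [Finset.sum_comm]
  rw [← Matrix.det_submatrix_equiv_self e, hfac, Matrix.det_mul, Matrix.det_mul,
    Matrix.det_transpose, hK, Matrix.det_fromBlocks_zero₂₁, Matrix.det_one]
  ring

/-- The eigenvalues of a circulant matrix are the values of the Fourier transform. -/
lemma det_circulant_eq_prod {N : ℕ} [NeZero N] (c : ZMod N → ℂ) :
    (Matrix.circulant c).det = ∏ j : ZMod N, ∑ x, c x * ZMod.stdAddChar (-(j * x)) := by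
  set χ : AddChar (ZMod N) ℂ := ZMod.stdAddChar with hχ
  let F : Matrix (ZMod N) (ZMod N) ℂ := Matrix.of fun w j => χ (j * w)
  let F' : Matrix (ZMod N) (ZMod N) ℂ := Matrix.of fun j w => χ (-(j * w))
  have hN : (N : ℂ) ≠ 0 := Nat.cast_ne_zero.2 (NeZero.ne N)
  have hF : F' * F = (N : ℂ) • 1 := by
    ext i j
    have h := AddChar.sum_mulShift (j - i) (ZMod.isPrimitive_stdAddChar N)
    rw [ZMod.card] at h
    have h2 : (F' * F) i j = ∑ x, χ (x * (j - i)) := by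
      rw [Matrix.mul_apply]
      refine Finset.sum_congr rfl fun x _ => ?_
      simp only [F, F', Matrix.of_apply]
      rw [← AddChar.map_add_eq_mul]
      congr 1
      ring
    rw [h2, h]
    by_cases hij : i = j
    · subst hij; simp
    · rw [if_neg (sub_ne_zero.2 (Ne.symm hij))]
      simp [hij]
  have hdet : F.det ≠ 0 := by
    intro h0
    have := congrArg Matrix.det hF
    rw [Matrix.det_mul, h0, mul_zero, Matrix.det_smul, Matrix.det_one, mul_one] at this
    exact pow_ne_zero _ hN this.symm
  have hmul : Matrix.circulant c * F =
      F * Matrix.diagonal fun j => ∑ x, c x * χ (-(j * x)) := by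
    ext v j
    rw [Matrix.mul_apply, Matrix.mul_diagonal, Finset.mul_sum]
    rw [← (Equiv.subLeft v).sum_comp]
    refine Finset.sum_congr rfl fun x _ => ?_
    simp only [F, Matrix.of_apply, Matrix.circulant_apply, Equiv.subLeft_apply, sub_sub_cancel]
    rw [mul_left_comm, ← AddChar.map_add_eq_mul]
    congr 2
    ring
  have := congrArg Matrix.det hmul
  rw [Matrix.det_mul, Matrix.det_mul, Matrix.det_diagonal, mul_comm] at this
  exact mul_left_cancel₀ hdet this

/-- `N` times the reduced determinant of the Laplacian of a Cayley digraph of `ℤ/N` is the product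
of the nontrivial Laplacian eigenvalues. -/
lemma card_mul_det_reduced_laplacian {N : ℕ} [NeZero N] {D : Type*} [Fintype D] (t : D → ZMod N)
    (r : ZMod N) :
    (N : ℂ) * (Matrix.of fun v w : {v : ZMod N // v ≠ r} =>
      ∑ d, ((if v = w then (1 : ℂ) else 0) - if (v + t d : ZMod N) = w then 1 else 0)).det =
    ∏ j ∈ Finset.univ.erase (0 : ZMod N), ∑ d, (1 - ZMod.stdAddChar (j * t d)) := by
  have hN : (N : ℂ) ≠ 0 := Nat.cast_ne_zero.2 (NeZero.ne N)
  let c : ZMod N → ℂ := fun x => ∑ d, ((if x = 0 then (1 : ℂ) else 0) - if -t d = x then 1 else 0)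
  have hc : ∑ x, c x = 0 := by
    simp only [c]
    rw [Finset.sum_comm]
    simp
  have hrow : ∀ v, ∑ w, Matrix.circulant c v w = 0 := fun v => by
    simp only [Matrix.circulant_apply]
    rw [← hc]
    exact (Equiv.subLeft v).sum_comp c
  have hcol : ∀ w, ∑ v, Matrix.circulant c v w = 0 := fun w => by
    simp only [Matrix.circulant_apply]
    rw [← hc]
    exact (Equiv.subRight w).sum_comp c
  have h1 := det_add_ones_eq r _ hrow hcol
  have h2 : Matrix.circulant c + (Matrix.of fun _ _ => 1) =
      Matrix.circulant fun x => c x + 1 := by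
    ext v w
    simp [Matrix.circulant_apply]
  have h3 : (Matrix.circulant c).submatrix (Subtype.val : {v : ZMod N // v ≠ r} → _) Subtype.val =
      Matrix.of fun v w : {v : ZMod N // v ≠ r} =>
        ∑ d, ((if v = w then (1 : ℂ) else 0) - if (v + t d : ZMod N) = w then 1 else 0) := by
    ext v w
    simp only [c, Matrix.submatrix_apply, Matrix.circulant_apply, Matrix.of_apply, sub_eq_zero,
      Subtype.ext_iff]
    refine Finset.sum_congr rfl fun d _ => ?_
    congr 2
    rw [neg_eq_iff_eq_neg, neg_sub, eq_sub_iff_add_eq', eq_iff_iff]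
  -- Adding J changes only the eigenvalue at frequency 0, from 0 to N.
  have h4 : ∀ j : ZMod N, ∑ x, (c x + 1) * (ZMod.stdAddChar (-(j * x)) : ℂ) =
      if j = 0 then (N : ℂ) else ∑ d, (1 - ZMod.stdAddChar (j * t d)) := by
    intro j
    have h5 : ∑ x, (ZMod.stdAddChar (-(j * x)) : ℂ) = if j = 0 then (N : ℂ) else 0 := by
      have h := AddChar.sum_mulShift (-j) (ZMod.isPrimitive_stdAddChar N)
      rw [ZMod.card] at h
      simp only [neg_eq_zero] at h
      rw [show ((if j = 0 then (N : ℂ) else 0) = ((if j = 0 then N else 0 : ℕ) : ℂ)) by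
        split_ifs <;> simp, ← h]
      refine Finset.sum_congr rfl fun x _ => ?_
      congr 1
      ring
    have h6 : ∑ x, c x * (ZMod.stdAddChar (-(j * x)) : ℂ) =
        ∑ d, (1 - ZMod.stdAddChar (j * t d)) := by
      simp only [c, Finset.sum_mul]
      rw [Finset.sum_comm]
      refine Finset.sum_congr rfl fun d _ => ?_
      simp [sub_mul, Finset.sum_sub_distrib]
    simp only [add_mul, one_mul, Finset.sum_add_distrib]
    rw [h5, h6]
    split_ifs with hj
    · simp [hj]
    · simp
  rw [h2, h3, det_circulant_eq_prod, ZMod.card] at h1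
  simp only [h4] at h1
  rw [← Finset.mul_prod_erase _ _ (Finset.mem_univ (0 : ZMod N)), if_pos rfl] at h1
  rw [Finset.prod_congr rfl fun j hj => if_neg (Finset.ne_of_mem_erase hj)] at h1
  refine mul_left_cancel₀ hN ?_
  rw [h1]
  ring

lemma card_mul_numSpanningTrees_circulantMultigraph {N : ℕ} [NeZero N] {ι : Type*} [Fintype ι]
    (a : ι → ℕ) (ha : ∀ i, (a i : ZMod N) ≠ 0) :
    (N : ℂ) * numSpanningTrees (circulantMultigraph N a) =
      ∏ j ∈ Finset.univ.erase (0 : ZMod N),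
        ∑ i, (2 - ZMod.stdAddChar (j * (a i : ZMod N)) -
          (ZMod.stdAddChar (-(j * (a i : ZMod N))) : ℂ)) := by
  -- Each jump gives two darts at `v`, one forward and one backward; their edges differ because the
  -- jump is nonzero mod N, even when it is N/2.
  let t : ι × Bool → ZMod N := fun d => bif d.2 then a d.1 else -a d.1
  let edge : ZMod N → ι × Bool → ι × ZMod N := fun v d => (d.1, bif d.2 then v else v - a d.1)
  rw [numSpanningTrees_eq_det (circulantMultigraph N a) rfl 0 (fun v d => v + t d) edge,
    card_mul_det_reduced_laplacian]
  · refine Finset.prod_congr rfl fun j _ => ?_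
    rw [Fintype.sum_prod_type]
    refine Finset.sum_congr rfl fun i _ => ?_
    rw [Fintype.sum_bool]
    simp only [t, cond_true, cond_false, mul_neg]
    ring
  · rintro v ⟨i, b⟩ ⟨i', b'⟩ h
    simp only [edge, Prod.mk.injEq] at h
    obtain ⟨rfl, h⟩ := h
    have := ha i
    cases b <;> cases b' <;> simp_all [eq_sub_iff_add_eq]
  · rintro v ⟨i, b⟩
    cases b
    · simp [circulantMultigraph, t, edge, sub_eq_add_neg]
    · simp [circulantMultigraph, t, edge]
  · rintro ⟨i, x⟩ v w h
    rcases Sym2.eq_iff.1 (show s(v, w) = s(x, x + (a i : ZMod N)) from h) with ⟨h1, h2⟩ | ⟨h1, h2⟩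
    · exact ⟨(i, true), by simp [edge, h1]⟩
    · exact ⟨(i, false), by simp [edge, h1]⟩

/-! ### Products of Chebyshev polynomials over arithmetic progressions of angles -/

lemma IsPrimitiveRoot.pow_sub_pow_eq_prod_range {R : Type*} [CommRing R] [IsDomain R] {n : ℕ}
    {ζ : R} (hζ : IsPrimitiveRoot ζ n) (hn : 0 < n) (x y : R) :
    x ^ n - y ^ n = ∏ t ∈ Finset.range n, (x - ζ ^ t * y) := by
  have := congrArg (eval x) (X_pow_sub_C_eq_prod hζ hn (rfl : y ^ n = y ^ n))
  simpa [eval_prod] using this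

/-- With w = cos φ, z = exp(iφ) and y = exp(iθ), each factor is z⁻¹(z - ζᵗy)(z - ζ⁻ᵗy⁻¹), and the
product over t is a factorization of zⁿ - yⁿ and zⁿ - y⁻ⁿ. -/
lemma prod_two_mul_sub_two_mul_cos {n : ℕ} (hn : 0 < n) (w θ : ℂ) :
    ∏ t ∈ Finset.range n, (2 * w - 2 * Complex.cos (θ + 2 * Real.pi * t / n)) =
      2 * (Chebyshev.T ℂ (n : ℤ)).eval w - 2 * Complex.cos (n * θ) := by
  obtain ⟨φ, rfl⟩ := Complex.cos_surjective w
  rw [Chebyshev.T_complex_cos]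
  have hn' : (n : ℂ) ≠ 0 := Nat.cast_ne_zero.2 hn.ne'
  have hζ := Complex.isPrimitiveRoot_exp n hn.ne'
  set ζ := Complex.exp (2 * Real.pi * Complex.I / n) with hζ'
  set z := Complex.exp (φ * Complex.I) with hz
  set y := Complex.exp (θ * Complex.I) with hy
  have hz0 : z ≠ 0 := Complex.exp_ne_zero _
  have hy0 : y ≠ 0 := Complex.exp_ne_zero _
  have hζ0 : ζ ≠ 0 := Complex.exp_ne_zero _
  have two_cos : ∀ x : ℂ, 2 * Complex.cos x =
      Complex.exp (x * Complex.I) + (Complex.exp (x * Complex.I))⁻¹ := fun x => by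
    rw [Complex.two_cos, ← Complex.exp_neg, neg_mul]
  have hexp : ∀ x : ℂ, Complex.exp ((n * x) * Complex.I) = Complex.exp (x * Complex.I) ^ n :=
    fun x => by rw [← Complex.exp_nat_mul]; ring_nf
  have hfac : ∀ a b : ℂ, a ≠ 0 → b ≠ 0 → a + a⁻¹ - (b + b⁻¹) = a⁻¹ * ((a - b) * (a - b⁻¹)) := by
    intro a b ha hb
    field_simp
    ring
  have hterm : ∀ t : ℕ, 2 * Complex.cos φ - 2 * Complex.cos (θ + 2 * Real.pi * t / n) =
      z⁻¹ * ((z - ζ ^ t * y) * (z - ζ⁻¹ ^ t * y⁻¹)) := fun t => by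
    have h : Complex.exp ((θ + 2 * Real.pi * t / n) * Complex.I) = ζ ^ t * y := by
      rw [hζ', hy, ← Complex.exp_nat_mul, ← Complex.exp_add]
      congr 1
      ring
    rw [two_cos, two_cos, h, ← hz, hfac _ _ hz0 (mul_ne_zero (pow_ne_zero _ hζ0) hy0), mul_inv,
      inv_pow]
  rw [Finset.prod_congr rfl fun t _ => hterm t, Finset.prod_mul_distrib, Finset.prod_mul_distrib,
    ← hζ.pow_sub_pow_eq_prod_range hn, ← hζ.inv.pow_sub_pow_eq_prod_range hn, Int.cast_natCast,
    two_cos, two_cos, hexp, hexp, ← hz, ← hy,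
    hfac _ _ (pow_ne_zero _ hz0) (pow_ne_zero _ hy0), Finset.prod_const, Finset.card_range,
    inv_pow, inv_pow]

/-- Evaluates a product with its vanishing factor removed: used with T_n - 1, where it gives n², and
with P_0, where it gives q. -/
lemma eval_one_of_two_mul_X_sub_two_mul_eq {P R : ℂ[X]} (h : 2 * P = (2 * X - 2) * R) :
    R.eval 1 = (derivative P).eval 1 := by
  have := congrArg (fun p => (derivative p).eval 1) h
  simp at this
  exact this.symm

lemma prod_erase_two_mul_sub_two_mul_cos_mul {n : ℕ} (hn : 0 < n) (w : ℂ) :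
    (∏ t ∈ (Finset.range n).erase 0, (2 * w - 2 * Complex.cos (2 * Real.pi * t / n))) *
      (2 * w - 2) = 2 * (Chebyshev.T ℂ (n : ℤ)).eval w - 2 := by
  have h := prod_two_mul_sub_two_mul_cos hn w 0
  rw [← Finset.prod_erase_mul _ _ (Finset.mem_range.2 hn)] at h
  simpa using h

lemma prod_erase_two_sub_two_mul_cos {n : ℕ} (hn : 0 < n) :
    ∏ t ∈ (Finset.range n).erase 0, (2 - 2 * Complex.cos (2 * Real.pi * t / n)) = (n : ℂ) ^ 2 := by
  have h : 2 * (Chebyshev.T ℂ (n : ℤ) - 1) = (2 * X - 2) *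
      ∏ t ∈ (Finset.range n).erase 0, (2 * X - C (2 * Complex.cos (2 * Real.pi * t / n))) := by
    refine Polynomial.funext fun w => ?_
    have := prod_erase_two_mul_sub_two_mul_cos_mul hn w
    simp only [eval_mul, eval_sub, eval_ofNat, eval_one, eval_X, eval_prod, eval_C]
    rw [mul_comm (2 * w - 2), this]
    ring
  have := eval_one_of_two_mul_X_sub_two_mul_eq h
  simpa [eval_prod, Chebyshev.derivative_T_eval_one] using this

section FactoredPolynomial

variable {m n : ℕ} {P : ℂ[X]} {w : Fin m → ℂ}

lemma prod_two_mul_eval_cos (hn : 0 < n) (hP : 2 * P = ∏ j, (2 * X - C (2 * w j))) (θ : ℂ) :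
    ∏ t ∈ Finset.range n, ‖2 * P.eval (Complex.cos (θ + 2 * Real.pi * t / n))‖ =
      ∏ j, ‖2 * (Chebyshev.T ℂ (n : ℤ)).eval (w j) - 2 * Complex.cos (n * θ)‖ := by
  have h : ∀ x, 2 * P.eval x = ∏ j, (2 * x - 2 * w j) := fun x => by
    have := congrArg (eval x) hP
    simpa [eval_prod] using this
  simp only [h, norm_prod]
  rw [Finset.prod_comm]
  refine Finset.prod_congr rfl fun j _ => ?_
  rw [← prod_two_mul_sub_two_mul_cos hn, norm_prod]
  exact Finset.prod_congr rfl fun t _ => norm_sub_rev _ _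

/-- The factor of the simple root 1 contributes n². Each other root w lacks the t = 0 factor 2w - 2,
and together these missing factors have the norm of P'(1), which is the multiplier on the left. -/
lemma prod_erase_two_mul_eval_cos_mul (hn : 0 < n) (hP : 2 * P = ∏ j, (2 * X - C (2 * w j)))
    (h1 : P.eval 1 = 0) (hd : (derivative P).eval 1 ≠ 0) :
    (∏ t ∈ (Finset.range n).erase 0, ‖2 * P.eval (Complex.cos (2 * Real.pi * t / n))‖) *
      ‖(derivative P).eval 1‖ =
      (n : ℝ) ^ 2 * ∏ j with w j ≠ 1, ‖2 * (Chebyshev.T ℂ (n : ℤ)).eval (w j) - 2‖ := by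
  have h : ∀ x, 2 * P.eval x = ∏ j, (2 * x - 2 * w j) := fun x => by
    have := congrArg (eval x) hP
    simpa [eval_prod] using this
  obtain ⟨j₀, -, hj₀⟩ := Finset.prod_eq_zero_iff.1 ((h 1).symm.trans (by rw [h1, mul_zero]))
  have hj₀ : w j₀ = 1 := by linear_combination (-1 / 2) * hj₀
  have hR : (∏ j ∈ Finset.univ.erase j₀, (2 * X - C (2 * w j))).eval 1 =
      (derivative P).eval 1 := by
    refine eval_one_of_two_mul_X_sub_two_mul_eq ?_
    rw [hP, ← Finset.mul_prod_erase _ _ (Finset.mem_univ j₀), hj₀, mul_one, map_ofNat]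
  have hR' : ∏ j ∈ Finset.univ.erase j₀, (2 - 2 * w j) = (derivative P).eval 1 := by
    rw [← hR]
    simp [eval_prod]
  -- A second index with root 1 would make the derivative at 1 vanish.
  have hfilter : (Finset.univ.filter fun j => w j ≠ 1) = Finset.univ.erase j₀ := by
    ext j
    simp only [Finset.mem_filter, Finset.mem_univ, true_and, Finset.mem_erase, and_true]
    refine ⟨fun hj hjj => hj (hjj ▸ hj₀), fun hj hj1 => hd ?_⟩
    rw [← hR']
    exact Finset.prod_eq_zero (Finset.mem_erase.2 ⟨hj, Finset.mem_univ _⟩) (by simp [hj1])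
  rw [hfilter, ← hR', norm_prod]
  have hterm : ∀ t : ℕ, ‖2 * P.eval (Complex.cos (2 * Real.pi * t / n))‖ =
      ‖2 - 2 * Complex.cos (2 * Real.pi * t / n)‖ *
        ∏ j ∈ Finset.univ.erase j₀, ‖2 * w j - 2 * Complex.cos (2 * Real.pi * t / n)‖ := fun t => by
    rw [h, norm_prod, ← Finset.mul_prod_erase _ _ (Finset.mem_univ j₀), hj₀, norm_sub_rev, mul_one]
    congr 1
    exact Finset.prod_congr rfl fun j _ => norm_sub_rev _ _
  rw [Finset.prod_congr rfl fun t _ => hterm t, Finset.prod_mul_distrib, ← norm_prod,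
    prod_erase_two_sub_two_mul_cos hn, Finset.prod_comm, mul_assoc, ← Finset.prod_mul_distrib]
  simp only [norm_pow, Complex.norm_natCast]
  congr 1
  refine Finset.prod_congr rfl fun j _ => ?_
  rw [← prod_erase_two_mul_sub_two_mul_cos_mul hn, norm_mul, norm_prod, norm_sub_rev 2]

end FactoredPolynomial

/-! ### The polynomials `chebyshevEquation` -/

section ChebyshevEquation

variable {k l : ℕ} {β : ℕ} {s : Fin k → ℕ} {α : Fin l → ℕ} {u : ℕ}

lemma natDegree_chebyshevEquation (hs : StrictMono s) (i₀ : Fin k) (hi₀ : ∀ i, i ≤ i₀)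
    (hpos : 1 ≤ s i₀) :
    (chebyshevEquation β s α u).natDegree = s i₀ ∧
      (chebyshevEquation β s α u).leadingCoeff = 2 ^ (s i₀ - 1) := by
  have hcoeff : (chebyshevEquation β s α u).coeff (s i₀) = 2 ^ (s i₀ - 1) := by
    rw [chebyshevEquation, coeff_sub, coeff_C, if_neg (by omega), sub_zero, finsetSum_coeff,
      Finset.sum_eq_single i₀]
    · have := Chebyshev.leadingCoeff_T ℂ (s i₀ : ℤ)
      rw [leadingCoeff, Chebyshev.natDegree_T] at this
      simpa using this
    · intro i _ hi
      refine coeff_eq_zero_of_natDegree_lt ?_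
      rw [Chebyshev.natDegree_T]
      simpa using hs (lt_of_le_of_ne (hi₀ i) hi)
    · simp
  have hle : (chebyshevEquation β s α u).natDegree ≤ s i₀ := by
    rw [chebyshevEquation, natDegree_sub_C]
    refine natDegree_sum_le_of_forall_le _ _ fun i _ => ?_
    rw [Chebyshev.natDegree_T]
    exact hs.monotone (hi₀ i)
  have hdeg : (chebyshevEquation β s α u).natDegree = s i₀ :=
    le_antisymm hle (le_natDegree_of_ne_zero (by rw [hcoeff]; exact pow_ne_zero _ two_ne_zero))
  exact ⟨hdeg, by rw [leadingCoeff, hdeg, hcoeff]⟩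

/-- Doubling turns the leading coefficient 2^(s - 1) into 2^s, one factor 2 for each root. -/
lemma two_mul_chebyshevEquation_eq_prod (hs : StrictMono s) (i₀ : Fin k) (hi₀ : ∀ i, i ≤ i₀)
    (hpos : 1 ≤ s i₀) (w : Fin (s i₀) → ℂ)
    (hw : Multiset.map w Finset.univ.val = (chebyshevEquation β s α u).roots) :
    2 * chebyshevEquation β s α u = ∏ j, (2 * X - C (2 * w j)) := by
  have h := (IsAlgClosed.splits (chebyshevEquation β s α u)).eq_prod_roots
  rw [(natDegree_chebyshevEquation hs i₀ hi₀ hpos).2, ← hw, Multiset.map_map] at h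
  have h2 : ∏ j, (2 * X - C (2 * w j)) = C ((2 : ℂ) ^ s i₀) * ∏ j, (X - C (w j)) := by
    have : ∀ j, (2 * X - C (2 * w j) : ℂ[X]) = C 2 * (X - C (w j)) := fun j => by
      rw [mul_sub, ← C_mul]; rfl
    rw [Finset.prod_congr rfl fun j _ => this j, Finset.prod_mul_distrib]
    simp
  rw [h2, h]
  obtain ⟨m, hm⟩ := Nat.exists_eq_succ_of_ne_zero (Nat.pos_iff_ne_zero.1 hpos)
  have h3 : (2 : ℂ) ^ s i₀ = 2 * 2 ^ (s i₀ - 1) := by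
    rw [hm, Nat.succ_sub_one, pow_succ, mul_comm]
  rw [h3, C_mul, mul_assoc]
  rfl

lemma eval_one_chebyshevEquation_zero : (chebyshevEquation β s α 0).eval 1 = 0 := by
  simp [chebyshevEquation, eval_finsetSum]

lemma eval_one_derivative_chebyshevEquation :
    (derivative (chebyshevEquation β s α u)).eval 1 = ∑ i, (s i : ℂ) ^ 2 := by
  rw [chebyshevEquation, derivative_sub, derivative_C, sub_zero, derivative_sum, eval_finsetSum]
  simp [Chebyshev.derivative_T_eval_one]

/-- The Laplacian eigenvalues of the circulant multigraph in terms of `chebyshevEquation`. -/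
lemma eigenvalue_eq_chebyshevEquation {n : ℕ} (hn : 0 < n) (hβ : 0 < β) [NeZero (β * n)] (t : ℕ) :
    ∑ i : Fin k ⊕ Fin l, (2 - ZMod.stdAddChar (((u + β * t : ℕ) : ZMod (β * n)) *
        ((Sum.elim s (fun m => α m * n) i : ℕ) : ZMod (β * n))) -
      (ZMod.stdAddChar (-(((u + β * t : ℕ) : ZMod (β * n)) *
        ((Sum.elim s (fun m => α m * n) i : ℕ) : ZMod (β * n)))) : ℂ)) =
    -(2 * (chebyshevEquation β s α u).eval
      (Complex.cos (2 * Real.pi * u / (β * n) + 2 * Real.pi * t / n))) := by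
  have hn' : (n : ℂ) ≠ 0 := Nat.cast_ne_zero.2 hn.ne'
  have hβ' : (β : ℂ) ≠ 0 := Nat.cast_ne_zero.2 hβ.ne'
  have hchar : ∀ j a : ℕ, 2 - ZMod.stdAddChar ((j : ZMod (β * n)) * (a : ZMod (β * n))) -
      (ZMod.stdAddChar (-((j : ZMod (β * n)) * (a : ZMod (β * n)))) : ℂ) =
      2 - 2 * Complex.cos (a * (2 * Real.pi * j / (β * n))) := by
    intro j a
    have h1 := ZMod.stdAddChar_coe (N := β * n) (j * a : ℤ)
    have h2 := ZMod.stdAddChar_coe (N := β * n) (-(j * a) : ℤ)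
    push_cast at h1 h2
    rw [h1, h2, Complex.two_cos, sub_sub]
    congr 3 <;> ring
  have hangle : (2 * Real.pi * u / (β * n) + 2 * Real.pi * t / n : ℂ) =
      2 * Real.pi * (u + β * t : ℕ) / (β * n) := by
    push_cast
    field_simp
  -- For a jump αₘn, the part of the angle depending on t is a whole number of turns.
  have hsin : ∀ m, (2 - 2 * Complex.cos ((α m * n : ℕ) *
      (2 * Real.pi * (u + β * t : ℕ) / (β * n))) : ℂ) =
      4 * ((Real.sin (Real.pi * u * α m / β) : ℝ) : ℂ) ^ 2 := by
    intro m
    have h : ((α m * n : ℕ) * (2 * Real.pi * (u + β * t : ℕ) / (β * n)) : ℂ) =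
        2 * (Real.pi * u * α m / β : ℝ) + (α m * t : ℕ) * (2 * Real.pi) := by
      push_cast
      field_simp
    rw [h, Complex.cos_add_nat_mul_two_pi, Complex.cos_two_mul, Complex.ofReal_sin, Complex.sin_sq]
    ring
  rw [Fintype.sum_sum_type]
  simp only [Sum.elim_inl, Sum.elim_inr, hchar, hsin]
  rw [hangle, chebyshevEquation]
  simp only [eval_sub, eval_finsetSum, Chebyshev.T_complex_cos, eval_C]
  push_cast
  rw [Finset.sum_sub_distrib, ← Finset.mul_sum, ← Finset.mul_sum]
  simp
  ring

end ChebyshevEquation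

/-! ### Splitting products over `ZMod (b * n)` by residues modulo b -/

lemma Finset.prod_range_mul_eq {M : Type*} [CommMonoid M] (b n : ℕ) (f : ℕ → M) :
    ∏ k ∈ Finset.range (b * n), f k =
      ∏ u ∈ Finset.range b, ∏ t ∈ Finset.range n, f (u + b * t) := by
  rw [Finset.prod_comm]
  induction n with
  | zero => simp
  | succ n ih =>
    rw [Nat.mul_succ, Finset.prod_range_add, ih, Finset.prod_range_succ]
    simp only [add_comm]

lemma ZMod.prod_eq_prod_range {M : Type*} [CommMonoid M] (N : ℕ) [NeZero N] (f : ZMod N → M) :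
    ∏ j, f j = ∏ k ∈ Finset.range N, f (k : ZMod N) :=
  Finset.prod_nbij' ZMod.val (fun k => (k : ZMod N)) (fun j _ => Finset.mem_range.2 j.val_lt)
    (fun _ _ => Finset.mem_univ _) (fun j _ => ZMod.natCast_zmod_val j)
    (fun k hk => ZMod.val_cast_of_lt (Finset.mem_range.1 hk)) (fun j _ => by
      rw [ZMod.natCast_zmod_val])

lemma ZMod.prod_erase_zero_eq {M : Type*} [CommMonoid M] {b n : ℕ} (hb : 0 < b) (hn : 0 < n)
    [NeZero (b * n)] (f : ZMod (b * n) → M) :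
    ∏ j ∈ Finset.univ.erase 0, f j =
      (∏ t ∈ (Finset.range n).erase 0, f ((0 + b * t : ℕ) : ZMod (b * n))) *
      ∏ u ∈ (Finset.range b).erase 0, ∏ t ∈ Finset.range n, f ((u + b * t : ℕ) : ZMod (b * n)) := by
  classical
  -- Replacing the value at 0 by 1 makes the erased product a full one, which can be reindexed.
  have h := ZMod.prod_eq_prod_range (b * n) (fun j => if j = 0 then 1 else f j)
  rw [Finset.prod_range_mul_eq, ← Finset.mul_prod_erase _ _ (Finset.mem_univ (0 : ZMod (b * n))),
    ← Finset.mul_prod_erase _ _ (Finset.mem_range.2 hb),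
    ← Finset.mul_prod_erase _ _ (Finset.mem_range.2 hn)] at h
  have hne : ∀ u t, u < b → t < n → (u ≠ 0 ∨ t ≠ 0) → ((u + b * t : ℕ) : ZMod (b * n)) ≠ 0 := by
    intro u t hu ht hut h0
    rw [ZMod.natCast_eq_zero_iff] at h0
    have hlt : u + b * t < b * n := by nlinarith [Nat.mul_le_mul_left b (Nat.succ_le_of_lt ht)]
    have := Nat.eq_zero_of_dvd_of_lt h0 hlt
    rcases hut with hu0 | ht0
    · omega
    · have := Nat.mul_pos hb (Nat.pos_of_ne_zero ht0)
      omega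
  rw [if_pos rfl, one_mul, if_pos (by simp), one_mul,
    Finset.prod_congr rfl fun j hj => if_neg (Finset.ne_of_mem_erase hj)] at h
  rw [h]
  congr 1
  · refine Finset.prod_congr rfl fun t ht => if_neg ?_
    rw [Finset.mem_erase, Finset.mem_range] at ht
    exact hne 0 t hb ht.2 (Or.inr ht.1)
  · refine Finset.prod_congr rfl fun u hu => Finset.prod_congr rfl fun t ht => if_neg ?_
    rw [Finset.mem_erase, Finset.mem_range] at hu
    exact hne u t hu.2 (Finset.mem_range.1 ht) (Or.inl hu.1)

/-- The number of spanning trees of a circulant multigraph with fixed and growing jumps, in terms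
of Chebyshev polynomials. -/
theorem theorem1 (n β k l : ℕ) (hn : 0 < n) (hβ : 0 < β) (hk : 0 < k)
    (s : Fin k → ℕ) (hs : StrictMono s) (hs_pos : ∀ i, 1 ≤ s i) (hs_le : ∀ i, s i ≤ β * n / 2)
    (α : Fin l → ℕ) (hα : StrictMono α) (hα_pos : ∀ m, 1 ≤ α m) (hα_le : ∀ m, α m ≤ β / 2) :
    (∀ u < β, (chebyshevEquation β s α u).roots.card = s ⟨k - 1, Nat.sub_one_lt_of_lt hk⟩) ∧
    ∀ w : ℕ → Fin (s ⟨k - 1, Nat.sub_one_lt_of_lt hk⟩) → ℂ,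
      (∀ u < β, Multiset.map (w u) Finset.univ.val = (chebyshevEquation β s α u).roots) →
      (numSpanningTrees
          (circulantMultigraph (β * n) (Sum.elim s (fun m => α m * n))) : ℝ) =
        (n : ℝ) / ((β : ℝ) * ∑ i, (s i : ℝ) ^ 2) *
          ∏ u ∈ Finset.range β, ∏ j with (u = 0 → w 0 j ≠ 1),
            ‖2 * (Chebyshev.T ℂ (n : ℤ)).eval (w u j) -
              2 * ((Real.cos (2 * Real.pi * u / β) : ℝ) : ℂ)‖ := by
  set i₀ : Fin k := ⟨k - 1, Nat.sub_one_lt_of_lt hk⟩ with hi₀'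
  have hi₀ : ∀ i, i ≤ i₀ := fun i => Fin.le_def.2 (Nat.le_sub_one_of_lt i.2)
  refine ⟨fun u _ => ?_, fun w hw => ?_⟩
  · rw [← (natDegree_chebyshevEquation hs i₀ hi₀ (hs_pos i₀)).1]
    exact (IsAlgClosed.splits _).natDegree_eq_card_roots.symm
  have hN : 0 < β * n := Nat.mul_pos hβ hn
  have : NeZero (β * n) := ⟨hN.ne'⟩
  have hjump : ∀ i, ((Sum.elim s (fun m => α m * n) i : ℕ) : ZMod (β * n)) ≠ 0 := by
    have key : ∀ a, 0 < a → a < β * n → (a : ZMod (β * n)) ≠ 0 := fun a h0 h1 h => by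
      rw [ZMod.natCast_eq_zero_iff] at h
      exact h0.ne' (Nat.eq_zero_of_dvd_of_lt h h1)
    rintro (i | m)
    · have := hs_le i
      exact key _ (hs_pos i) (by simp only [Sum.elim_inl]; omega)
    · have := hα_le m
      exact key _ (Nat.mul_pos (hα_pos m) hn)
        (Nat.mul_lt_mul_of_pos_right (by omega) hn)
  have htree := congrArg norm (card_mul_numSpanningTrees_circulantMultigraph _ hjump)
  rw [norm_mul, Complex.norm_natCast, Complex.norm_natCast, ZMod.prod_erase_zero_eq hβ hn,
    norm_mul] at htree
  simp only [norm_prod, eigenvalue_eq_chebyshevEquation hn hβ, norm_neg] at htree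
  simp only [Nat.cast_zero, mul_zero, zero_div, zero_add] at htree
  have hfac : ∀ u < β, 2 * chebyshevEquation β s α u = ∏ j, (2 * X - C (2 * w u j)) :=
    fun u hu => two_mul_chebyshevEquation_eq_prod hs i₀ hi₀ (hs_pos i₀) (w u) (hw u hu)
  set q : ℝ := ∑ i, (s i : ℝ) ^ 2 with hq
  have hq_pos : 0 < q := Finset.sum_pos
    (fun i _ => pow_pos (Nat.cast_pos.2 (hs_pos i)) 2) ⟨i₀, Finset.mem_univ _⟩
  have hderiv : (derivative (chebyshevEquation β s α 0)).eval 1 = (q : ℂ) := by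
    rw [eval_one_derivative_chebyshevEquation, hq]
    push_cast
    rfl
  have hzero := prod_erase_two_mul_eval_cos_mul hn (hfac 0 hβ) eval_one_chebyshevEquation_zero
    (by rw [hderiv]; exact_mod_cast hq_pos.ne')
  rw [hderiv, Complex.norm_real, Real.norm_of_nonneg hq_pos.le] at hzero
  have hpos : ∀ u ∈ (Finset.range β).erase 0,
      ∏ t ∈ Finset.range n, ‖2 * (chebyshevEquation β s α u).eval
        (Complex.cos (2 * Real.pi * u / (β * n) + 2 * Real.pi * t / n))‖ =
      ∏ j with (u = 0 → w 0 j ≠ 1), ‖2 * (Chebyshev.T ℂ (n : ℤ)).eval (w u j) -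
        2 * ((Real.cos (2 * Real.pi * u / β) : ℝ) : ℂ)‖ := by
    intro u hu
    rw [Finset.mem_erase, Finset.mem_range] at hu
    rw [prod_two_mul_eval_cos hn (hfac u hu.2), Finset.filter_true_of_mem fun j _ h => absurd h hu.1]
    refine Finset.prod_congr rfl fun j _ => ?_
    have hn' : (n : ℂ) ≠ 0 := Nat.cast_ne_zero.2 hn.ne'
    have hangle : (n * (2 * Real.pi * u / (β * n)) : ℂ) = 2 * Real.pi * u / β := by field_simp
    rw [hangle]
    push_cast
    rfl
  rw [Finset.prod_congr rfl hpos] at htree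
  rw [← Finset.mul_prod_erase _ _ (Finset.mem_range.2 hβ)]
  simp only [forall_const, Nat.cast_zero, mul_zero, zero_div, Real.cos_zero, Complex.ofReal_one,
    mul_one]
  have hn' : (n : ℝ) ≠ 0 := Nat.cast_ne_zero.2 hn.ne'
  have hβ' : (β : ℝ) ≠ 0 := Nat.cast_ne_zero.2 hβ.ne'
  rw [← eq_div_iff hq_pos.ne'] at hzero
  rw [hzero] at htree
  -- With βn on both sides, the n²/q from u = 0 matches βn · n/(βq).
  refine mul_left_cancel₀ (mul_ne_zero hβ' hn') ?_
  rw [Nat.cast_mul] at htree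
  have hcancel : ∀ A B : ℝ, (n : ℝ) ^ 2 * A / q * B = β * n * (n / (β * q) * (A * B)) :=
    fun A B => by field_simp
  exact htree.trans (hcancel _ _)
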